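/- Let $\mathcal H$ be a complex Hilbert space, let $e\in\mathcal B(\mathcal H)$ be an orthogonal projection and let $u\in\mathcal B(\mathcal H)$ be a hermitian involution ($u=u^*$, $u^2=I$). Let $\mathcal H_\pm$ be the eigenspace of $u$ corresponding to $\pm1$, let $\mathcal W(e,u)$ be the von Neumann algebra ($W^*$-algebra) generated by $e$ and $u$, let $\mathcal Q_u$ be the set of all orthogonal projections $q\in\mathcal B(\mathcal H)$ with $quq=0$, and let $d$ be the distance, in the operator norm, from $e$ to $\mathcal Q_u\cap\mathcal W(e,u)$. Put $\mathcal M_{00}=\operatorname{ran}e\cap\mathcal H_+$, $\mathcal M_{01}=\ker e\cap\mathcal H_+$, $\mathcal M_{10}=\ker e\cap\mathcal H_-$, $\mathcal M_{11}=\operatorname{ran}e\cap\mathcal H_-$ and $\mathcal M=\mathcal H_+\ominus(\mathcal M_{00}\oplus\mathcal M_{01})$, and let $H$ be the compression of $e$ onto $\mathcal M$. A *Halmos canonical form* of $(e,u)$ is a unitary identification of $\mathcal M\oplus\mathcal M$ with $(\mathcal M_{00}\oplus\mathcal M_{01}\oplus\mathcal M_{10}\oplus\mathcal M_{11})^\perp$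 that is the identity on the first copy of $\mathcal M$ and under which $u$ and $e$ restrict to $$\begin{bmatrix} I&0\\0&-I\end{bmatrix}\quad\text{and}\quad \begin{bmatrix}H&\sqrt{H(I-H)}\\ \sqrt{H(I-H)}&I-H\end{bmatrix}.$$ 1. If $\mathcal M_{00}\neq\{0\}$ or $\mathcal M_{11}\neq\{0\}$, then $d=1$. 2. If $\mathcal M_{00}=\mathcal M_{11}=\{0\}$, then $$d=\sqrt{\tfrac12\left(1-\sqrt{1-\|eue\|^2}\right)}.$$ Moreover, $(e,u)$ has a Halmos canonical form, and for every such form the operator $q_0$ that equals $\frac12\begin{bmatrix}I&I\\I&I\end{bmatrix}$ on $\mathcal M\oplus\mathcal M$ and $0$ on $\mathcal M_{00}\oplus\mathcal M_{01}\oplus\mathcal M_{10}\oplus\mathcal M_{11}$ belongs to $\mathcal Q_u\cap\mathcal W(e,u)$ and satisfies $\|e-q_0\|=d$. -/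

import Mathlib

noncomputable section

namespace ProjDist

universe v

variable {H : Type v} [NormedAddCommGroup H] [InnerProductSpace ℂ H] [CompleteSpace H]

/-- A hermitian involution: a self-adjoint operator `u` with `u² = I`. -/
structure IsHermitianInvolution (u : H →L[ℂ] H) : Prop where
  isSelfAdjoint : IsSelfAdjoint u
  mul_self : u * u = 1

/-- The set of all orthogonal projections `q` on `H` with `q u q = 0`. -/
def projQ (u : H →L[ℂ] H) : Set (H →L[ℂ] H) :=
  {q | IsStarProjection q ∧ q * u * q = 0}

/-- The W*-algebra (von Neumann algebra) generated by a set of bounded operators, as the double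
commutant of the set and its adjoints. By `subset_wStar` and `wStar_le` it is
the smallest von Neumann algebra on `H` that contains the set. -/
def wStar (S : Set (H →L[ℂ] H)) : VonNeumannAlgebra H where
  toStarSubalgebra :=
    StarSubalgebra.centralizer ℂ (Set.centralizer (S ∪ star S))
  centralizer_centralizer' := by
    have h : star (Set.centralizer (S ∪ star S)) = Set.centralizer (S ∪ star S) := by
      rw [Set.star_centralizer, Set.union_star, star_star, Set.union_comm]
    change Set.centralizer (Set.centralizer
      (StarSubalgebra.centralizer ℂ (Set.centralizer (S ∪ star S)) : Set (H →L[ℂ] H))) =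
      (StarSubalgebra.centralizer ℂ (Set.centralizer (S ∪ star S)) : Set (H →L[ℂ] H))
    rw [StarSubalgebra.coe_centralizer, h, Set.union_self, Set.centralizer_centralizer_centralizer]

theorem coe_wStar (S : Set (H →L[ℂ] H)) :
    (wStar S : Set (H →L[ℂ] H)) = Set.centralizer (Set.centralizer (S ∪ star S)) := by
  have h : star (Set.centralizer (S ∪ star S)) = Set.centralizer (S ∪ star S) := by
    rw [Set.star_centralizer, Set.union_star, star_star, Set.union_comm]
  change (StarSubalgebra.centralizer ℂ (Set.centralizer (S ∪ star S)) : Set (H →L[ℂ] H)) = _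
  rw [StarSubalgebra.coe_centralizer, h, Set.union_self]

theorem subset_wStar (S : Set (H →L[ℂ] H)) : S ⊆ (wStar S : Set (H →L[ℂ] H)) := by
  rw [coe_wStar]
  exact Set.subset_union_left.trans Set.subset_centralizer_centralizer

theorem wStar_le {S : Set (H →L[ℂ] H)} {W : VonNeumannAlgebra H}
    (h : S ⊆ (W : Set (H →L[ℂ] H))) :
    (wStar S : Set (H →L[ℂ] H)) ⊆ (W : Set (H →L[ℂ] H)) := by
  rw [coe_wStar, ← W.centralizer_centralizer]
  refine Set.centralizer_subset (Set.centralizer_subset (Set.union_subset h ?_))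
  intro x hx
  have := star_mem (h (Set.mem_star.mp hx))
  rwa [star_star] at this

/-- The set whose distance from `e` is taken is never empty. -/
theorem zero_mem (u : H →L[ℂ] H) (S : Set (H →L[ℂ] H)) :
    (0 : H →L[ℂ] H) ∈ projQ u ∩ (wStar S : Set (H →L[ℂ] H)) :=
  ⟨⟨⟨by simp [IsIdempotentElem], by simp⟩, by simp⟩, (wStar S).zero_mem'⟩

/-- The eigenspace of `u` for the eigenvalue `1`. -/
def eigPlus (u : H →L[ℂ] H) : Submodule ℂ H :=
  Module.End.eigenspace (u : H →ₗ[ℂ] H) 1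

/-- The eigenspace of `u` for the eigenvalue `-1`. -/
def eigMinus (u : H →L[ℂ] H) : Submodule ℂ H :=
  Module.End.eigenspace (u : H →ₗ[ℂ] H) (-1)

/-! The four summands of `H` on which both `e` and `u` are scalar. -/

def M00 (e u : H →L[ℂ] H) : Submodule ℂ H := e.range ⊓ eigPlus u

def M01 (e u : H →L[ℂ] H) : Submodule ℂ H := e.ker ⊓ eigPlus u

def M10 (e u : H →L[ℂ] H) : Submodule ℂ H := e.ker ⊓ eigMinus u

def M11 (e u : H →L[ℂ] H) : Submodule ℂ H := e.range ⊓ eigMinus u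

/-- The subspace `M`: the orthogonal complement of `M00 ⊕ M01` in the eigenspace of `u` for `1`. -/
def genM (e u : H →L[ℂ] H) : Submodule ℂ H := eigPlus u ⊓ (M00 e u ⊔ M01 e u)ᗮ

theorem isClosed_genM (e u : H →L[ℂ] H) : IsClosed (genM e u : Set H) := by
  have h1 : IsClosed (eigPlus u : Set H) := by
    have : (eigPlus u : Set H) = {x | u x = x} := by
      ext x
      simp [eigPlus]
    rw [this]
    exact isClosed_eq u.continuous continuous_id
  exact h1.inter (Submodule.isClosed_orthogonal _)

instance (e u : H →L[ℂ] H) : CompleteSpace (genM e u) :=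
  (isClosed_genM e u).completeSpace_coe

/-- The compression of `e` onto the subspace `M`. -/
def compH (e u : H →L[ℂ] H) : genM e u →L[ℂ] genM e u :=
  (genM e u).orthogonalProjectionOnto ∘L e ∘L (genM e u).subtypeL

/-- The positive square root of a positive operator. -/
def opSqrt {K : Type v} [NormedAddCommGroup K] [InnerProductSpace ℂ K] [CompleteSpace K]
    (A : K →L[ℂ] K) : K →L[ℂ] K :=
  CFC.sqrt A

theorem opSqrt_spec {K : Type v} [NormedAddCommGroup K] [InnerProductSpace ℂ K] [CompleteSpace K]
    (A : K →L[ℂ] K) (hA : 0 ≤ A) : 0 ≤ opSqrt A ∧ opSqrt A * opSqrt A = A :=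
  ⟨CFC.sqrt_nonneg A, CFC.sqrt_mul_sqrt_self A hA⟩

/-- The operator on the Hilbert space direct sum `K ⊕ K` with block matrix `[[A, B], [C, D]]`. -/
def blockOp {K : Type v} [NormedAddCommGroup K] [InnerProductSpace ℂ K]
    (A B C D : K →L[ℂ] K) : WithLp 2 (K × K) →L[ℂ] WithLp 2 (K × K) :=
  ((WithLp.prodContinuousLinearEquiv 2 ℂ K K).symm : K × K →L[ℂ] WithLp 2 (K × K)) ∘L
    ((A.coprod B).prod (C.coprod D)) ∘L
    (WithLp.prodContinuousLinearEquiv 2 ℂ K K : WithLp 2 (K × K) →L[ℂ] K × K)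

theorem blockOp_apply {K : Type v} [NormedAddCommGroup K] [InnerProductSpace ℂ K]
    (A B C D : K →L[ℂ] K) (x y : K) :
    blockOp A B C D (WithLp.toLp 2 (x, y)) = WithLp.toLp 2 (A x + B y, C x + D y) := rfl

/-- Halmos' canonical form of the pair `e, u`: an identification `J` of `M ⊕ M` with the orthogonal
complement of `M00 ⊕ M01 ⊕ M10 ⊕ M11`, the identity on the first copy of `M`, under which `u` and
`e` become the block operators `diag[I, -I]` and
`[[H, √(H(I - H))], [√(H(I - H)), I - H]]`, where `H` is the compression of `e` onto `M`.
(On `M00, M01, M10, M11` the pair `(u, e)` is `(I, I), (I, 0), (-I, 0), (-I, I)` by definition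
of these subspaces.) -/
structure HalmosForm (e u : H →L[ℂ] H) where
  J : WithLp 2 (genM e u × genM e u) →ₗᵢ[ℂ] H
  range_J : J.toLinearMap.range = (M00 e u ⊔ M01 e u ⊔ M10 e u ⊔ M11 e u)ᗮ
  J_fst : ∀ x : genM e u, J (WithLp.toLp 2 (x, 0)) = (x : H)
  u_form : u ∘L J.toContinuousLinearMap = J.toContinuousLinearMap ∘L blockOp 1 0 0 (-1)
  e_form : e ∘L J.toContinuousLinearMap = J.toContinuousLinearMap ∘L
    blockOp (compH e u) (opSqrt (compH e u * (1 - compH e u)))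
      (opSqrt (compH e u * (1 - compH e u))) (1 - compH e u)

/-- The operator `q₀`: it is `½ [[I, I], [I, I]]` on `M ⊕ M` and zero on the four other summands. -/
def HalmosForm.q0 {e u : H →L[ℂ] H} (F : HalmosForm e u) : H →L[ℂ] H :=
  F.J.toContinuousLinearMap ∘L ((1 / 2 : ℂ) • blockOp 1 1 1 1) ∘L
    ContinuousLinearMap.adjoint F.J.toContinuousLinearMap

end ProjDist

end

/-!
Split `e = G + T` into the parts `G` and `T` that commute and anticommute with `u`. From `e² = e`
one gets `G T + T G = T` and `T² = G - G²`. The kernel of `T` is the sum of the four subspaces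
on which `e` and `u` are both scalar (`ker_oddPart`), so `M` is the part of the orthogonal
complement of `ker T` that lies in the eigenspace of `u` for `1`, and on `M` the compression `H` is
`G` and `D = √(H(I - H))` is the absolute value of `T`. The polar decomposition `T = V D` on `M`
yields an isometry `V` into the eigenspace for `-1`, and `(x, y) ↦ x + V y` is a Halmos
form (`nonempty_halmosForm`).

Given any Halmos form, the flip `(x, y) ↦ (y, x)`, extended by zero, is the partial isometry in the
polar decomposition of the odd part `T`, and `2 q₀` is the flip plus its square. Hence `q₀` commutes
with everything that commutes with `e` and `u`, so it lies in the von Neumann algebra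
(`q0_mem_wStar`). Further `(e - q₀)² = diag[½ - D, ½ - D]`, and `e u e = (2 H - I) e` on the generic
part gives `‖2 H - I‖ ≤ ‖e u e‖`, hence `D ≥ ½ √(1 - ‖e u e‖²)` by operator monotonicity of the
square root. This is the upper bound for the distance (`norm_sub_q0_le`).

The lower bound (`sqrt_le_norm_sub`) holds for every `q` with `q u q = 0`. A vector in the range of
`q` has components of equal norm in the two eigenspaces of `u`, so Cauchy-Schwarz bounds `‖q x‖`
for `x` in the range of `e` in terms of `⟪u x, x⟫`, whose supremum in absolute value over unit
vectors is `‖e u e‖`.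

If `e` and `u` have a common eigenvector `x` with `e x = x`, the projection onto its line lies in the
commutant, so `x` is an eigenvector of every `q` in the von Neumann algebra. Then `q u q = 0`
forces `q x = 0` and `‖e - q‖ ≥ 1`, while `q = 0` attains the value `1` (`infDist_eq_one`).
-/

noncomputable section

namespace ProjDist

open scoped InnerProductSpace

universe v

/-! ### The even and odd parts of a projection with respect to an involution -/

variable {H : Type v} [NormedAddCommGroup H] [InnerProductSpace ℂ H]

/-- The part of `e` that anticommutes with the involution `u`. -/
def oddPart (e u : H →L[ℂ] H) : H →L[ℂ] H := (1 / 2 : ℂ) • (e - u * e * u)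

/-- The part of `e` that commutes with the involution `u`. -/
def evenPart (e u : H →L[ℂ] H) : H →L[ℂ] H := (1 / 2 : ℂ) • (e + u * e * u)

theorem evenPart_add_oddPart (e u : H →L[ℂ] H) : evenPart e u + oddPart e u = e := by
  simp only [evenPart, oddPart]
  module

theorem oddPart_apply (e u : H →L[ℂ] H) (x : H) :
    oddPart e u x = (1 / 2 : ℂ) • (e x - u (e (u x))) := rfl

theorem evenPart_apply (e u : H →L[ℂ] H) (x : H) :
    evenPart e u x = (1 / 2 : ℂ) • (e x + u (e (u x))) := rfl

theorem mem_eigPlus {u : H →L[ℂ] H} {x : H} : x ∈ eigPlus u ↔ u x = x := by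
  simp [eigPlus]

theorem mem_eigMinus {u : H →L[ℂ] H} {x : H} : x ∈ eigMinus u ↔ u x = -x := by
  simp [eigMinus]

variable [CompleteSpace H]

namespace IsHermitianInvolution

variable {u : H →L[ℂ] H} (hu : IsHermitianInvolution u)
include hu

theorem apply_apply (x : H) : u (u x) = x := congr($hu.mul_self x)

theorem inner_left (x y : H) : ⟪u x, y⟫_ℂ = ⟪x, u y⟫_ℂ := by
  rw [← ContinuousLinearMap.adjoint_inner_right, hu.isSelfAdjoint.adjoint_eq]

theorem inner_eq_zero {x y : H} (hx : u x = x) (hy : u y = -y) : ⟪x, y⟫_ℂ = 0 := by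
  have h := hu.inner_left x y
  rw [hx, hy, inner_neg_right] at h
  exact CharZero.eq_neg_self_iff.mp h

theorem apply_oddPart (e : H →L[ℂ] H) (x : H) : u (oddPart e u x) = -oddPart e u (u x) := by
  simp only [oddPart_apply, map_smul, map_sub, hu.apply_apply]
  module

theorem apply_evenPart (e : H →L[ℂ] H) (x : H) : u (evenPart e u x) = evenPart e u (u x) := by
  simp only [evenPart_apply, map_smul, map_add, hu.apply_apply]
  module

variable {e : H →L[ℂ] H}

theorem evenPart_oddPart (he : IsStarProjection e) (x : H) :
    evenPart e u (oddPart e u x) = oddPart e u x - oddPart e u (evenPart e u x) := by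
  have hee (y : H) : e (e y) = e y := congr($he.isIdempotentElem.eq y)
  simp only [evenPart_apply, oddPart_apply, map_smul, map_add, map_sub, hu.apply_apply, hee]
  module

theorem oddPart_oddPart (he : IsStarProjection e) (x : H) :
    oddPart e u (oddPart e u x) = evenPart e u x - evenPart e u (evenPart e u x) := by
  have hee (y : H) : e (e y) = e y := congr($he.isIdempotentElem.eq y)
  simp only [evenPart_apply, oddPart_apply, map_smul, map_add, map_sub, hu.apply_apply, hee]
  module

theorem inner_oddPart_left (he : IsStarProjection e) (x y : H) :
    ⟪oddPart e u x, y⟫_ℂ = ⟪x, oddPart e u y⟫_ℂ := by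
  have hee (x y : H) : ⟪e x, y⟫_ℂ = ⟪x, e y⟫_ℂ := by
    rw [← ContinuousLinearMap.adjoint_inner_right, he.isSelfAdjoint.adjoint_eq]
  simp only [oddPart_apply, inner_smul_left, inner_smul_right, inner_sub_left, inner_sub_right,
    hee, hu.inner_left]
  simp [map_ofNat]

theorem inner_evenPart_left (he : IsStarProjection e) (x y : H) :
    ⟪evenPart e u x, y⟫_ℂ = ⟪x, evenPart e u y⟫_ℂ := by
  have hee (x y : H) : ⟪e x, y⟫_ℂ = ⟪x, e y⟫_ℂ := by
    rw [← ContinuousLinearMap.adjoint_inner_right, he.isSelfAdjoint.adjoint_eq]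
  simp only [evenPart_apply, inner_smul_left, inner_smul_right, inner_add_left, inner_add_right,
    hee, hu.inner_left]
  simp [map_ofNat]

theorem ker_oddPart (he : IsStarProjection e) :
    (oddPart e u).ker = M00 e u ⊔ M01 e u ⊔ M10 e u ⊔ M11 e u := by
  have hee (y : H) : e (e y) = e y := congr($he.isIdempotentElem.eq y)
  apply le_antisymm
  · intro z hz
    have hz0 : oddPart e u z = 0 := hz
    have hz1 : e z = u (e (u z)) := by
      rw [oddPart_apply] at hz0
      simpa [sub_eq_zero] using hz0
    have hz2 : e (u z) = u (e z) := by rw [hz1, hu.apply_apply]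
    have h00 : (1 / 2 : ℂ) • (e z + u (e z)) ∈ M00 e u :=
      ⟨⟨(1 / 2 : ℂ) • (z + u z), by simp [hz2]⟩, mem_eigPlus.2 (by simp [hu.apply_apply, add_comm])⟩
    have h11 : (1 / 2 : ℂ) • (e z - u (e z)) ∈ M11 e u :=
      ⟨⟨(1 / 2 : ℂ) • (z - u z), by simp [hz2]⟩, mem_eigMinus.2 (by
        simp only [map_smul, map_sub, hu.apply_apply]; module)⟩
    have h01 : (1 / 2 : ℂ) • ((z - e z) + u (z - e z)) ∈ M01 e u := by
      refine ⟨?_, mem_eigPlus.2 ?_⟩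
      · rw [SetLike.mem_coe, LinearMap.mem_ker]
        have : e (u (e z)) = u (e z) := by rw [← hz2, hee]
        simp [hee, hz2, this]
      · simp only [map_smul, map_add, hu.apply_apply]; module
    have h10 : (1 / 2 : ℂ) • ((z - e z) - u (z - e z)) ∈ M10 e u := by
      refine ⟨?_, mem_eigMinus.2 ?_⟩
      · rw [SetLike.mem_coe, LinearMap.mem_ker]
        have : e (u (e z)) = u (e z) := by rw [← hz2, hee]
        simp [hee, hz2, this]
      · simp only [map_smul, map_sub, hu.apply_apply]; module
    have hs := Submodule.add_mem_sup (Submodule.add_mem_sup (Submodule.add_mem_sup h00 h01) h10) h11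
    convert hs using 1
    module
  · refine sup_le (sup_le (sup_le ?_ ?_) ?_) ?_
    · rintro _ ⟨⟨y, rfl⟩, hx⟩
      have hx := mem_eigPlus.1 hx
      rw [ContinuousLinearMap.coe_coe] at hx
      simp [oddPart_apply, hx, hee]
    · rintro x ⟨hx, hx'⟩
      have hx : e x = 0 := hx
      simp [oddPart_apply, mem_eigPlus.1 hx', hx]
    · rintro x ⟨hx, hx'⟩
      have hx : e x = 0 := hx
      simp [oddPart_apply, mem_eigMinus.1 hx', hx]
    · rintro _ ⟨⟨y, rfl⟩, hx⟩
      have hx := mem_eigMinus.1 hx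
      rw [ContinuousLinearMap.coe_coe] at hx
      simp [oddPart_apply, hx, hee]

theorem mem_genM (he : IsStarProjection e) {x : H} :
    x ∈ genM e u ↔ u x = x ∧ x ∈ (oddPart e u).kerᗮ := by
  rw [genM, Submodule.mem_inf, mem_eigPlus, hu.ker_oddPart he]
  refine and_congr_right fun hx => ?_
  have hm {N : Submodule ℂ H} (hN : N ≤ eigMinus u) : x ∈ Nᗮ := by
    rw [Submodule.mem_orthogonal']
    exact fun y hy => hu.inner_eq_zero hx (mem_eigMinus.1 (hN hy))
  rw [sup_assoc (M00 e u ⊔ M01 e u), ← Submodule.inf_orthogonal (M00 e u ⊔ M01 e u),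
    Submodule.mem_inf, ← Submodule.inf_orthogonal (M10 e u), Submodule.mem_inf]
  exact ⟨fun h => ⟨h, hm inf_le_right, hm inf_le_right⟩, fun h => h.1⟩

theorem oddPart_mem_orthogonal_ker (he : IsStarProjection e) (x : H) :
    oddPart e u x ∈ (oddPart e u).kerᗮ := by
  rw [Submodule.mem_orthogonal']
  intro y hy
  have hy : oddPart e u y = 0 := hy
  rw [hu.inner_oddPart_left he, hy, inner_zero_right]

theorem evenPart_mem_orthogonal_ker (he : IsStarProjection e) {x : H}
    (hx : x ∈ (oddPart e u).kerᗮ) : evenPart e u x ∈ (oddPart e u).kerᗮ := by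
  rw [Submodule.mem_orthogonal'] at hx ⊢
  intro y hy
  rw [hu.inner_evenPart_left he]
  refine hx _ ?_
  have hy : oddPart e u y = 0 := hy
  have h := hu.evenPart_oddPart he y
  rw [hy, map_zero, zero_sub, eq_comm, neg_eq_zero] at h
  exact h

theorem apply_mem_orthogonal_ker {x : H}
    (hx : x ∈ (oddPart e u).kerᗮ) : u x ∈ (oddPart e u).kerᗮ := by
  rw [Submodule.mem_orthogonal'] at hx ⊢
  intro y hy
  rw [hu.inner_left]
  refine hx _ ?_
  have hy : oddPart e u y = 0 := hy
  have h := hu.apply_oddPart e y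
  rw [hy, map_zero, eq_comm, neg_eq_zero] at h
  exact h

theorem evenPart_mem_genM (he : IsStarProjection e) {x : H} (hx : x ∈ genM e u) :
    evenPart e u x ∈ genM e u := by
  rw [hu.mem_genM he] at hx ⊢
  exact ⟨by rw [hu.apply_evenPart, hx.1], hu.evenPart_mem_orthogonal_ker he hx.2⟩

theorem coe_compH (he : IsStarProjection e) (x : genM e u) :
    (compH e u x : H) = evenPart e u x := by
  have hx := (hu.mem_genM he).1 x.2
  have h1 : e x = evenPart e u x + oddPart e u x := by
    rw [← add_apply, evenPart_add_oddPart]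
  have h2 : oddPart e u x ∈ (genM e u)ᗮ := by
    rw [Submodule.mem_orthogonal]
    intro y hy
    refine hu.inner_eq_zero ((hu.mem_genM he).1 hy).1 ?_
    rw [hu.apply_oddPart, hx.1]
  have h3 : compH e u x = (genM e u).orthogonalProjectionOnto (e x) := rfl
  rw [h3, h1, map_add, Submodule.orthogonalProjectionOnto_apply_of_mem_orthogonal h2, add_zero]
  exact congr(($(Submodule.orthogonalProjectionOnto_mem_subspace_eq_self
    (⟨_, hu.evenPart_mem_genM he x.2⟩ : genM e u)) : H))

theorem coe_compH_mul (he : IsStarProjection e) (x : genM e u) :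
    ((compH e u * (1 - compH e u)) x : H) = oddPart e u (oddPart e u x) := by
  rw [hu.oddPart_oddPart he]
  simp [hu.coe_compH he]

theorem compH_mul_nonneg (he : IsStarProjection e) : 0 ≤ compH e u * (1 - compH e u) := by
  rw [ContinuousLinearMap.nonneg_iff_isPositive, ContinuousLinearMap.isPositive_iff_complex]
  intro x
  rw [Submodule.coe_inner, hu.coe_compH_mul he, hu.inner_oddPart_left he,
    inner_self_eq_norm_sq_to_K]
  norm_cast
  exact ⟨rfl, by positivity⟩

end IsHermitianInvolution

/-! ### Existence of the canonical form -/

section OpSqrt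

variable {K : Type v} [NormedAddCommGroup K] [InnerProductSpace ℂ K] [CompleteSpace K]

theorem opSqrt_nonneg (A : K →L[ℂ] K) : 0 ≤ opSqrt A := CFC.sqrt_nonneg A

theorem opSqrt_isSelfAdjoint (A : K →L[ℂ] K) : IsSelfAdjoint (opSqrt A) :=
  IsSelfAdjoint.of_nonneg (opSqrt_nonneg A)

theorem commute_opSqrt {A B : K →L[ℂ] K} (h : Commute A B) : Commute (opSqrt A) B := by
  rw [opSqrt, CFC.sqrt_eq_cfc]
  exact h.cfc_nnreal _

end OpSqrt


/-- The off-diagonal entry `√(H(I - H))` of the projection `e` in Halmos' canonical form. -/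
def compD (e u : H →L[ℂ] H) : genM e u →L[ℂ] genM e u :=
  opSqrt (compH e u * (1 - compH e u))

theorem compD_nonneg (e u : H →L[ℂ] H) : 0 ≤ compD e u := opSqrt_nonneg _

theorem compD_isSelfAdjoint (e u : H →L[ℂ] H) : IsSelfAdjoint (compD e u) :=
  opSqrt_isSelfAdjoint _

theorem inner_compD_left (e u : H →L[ℂ] H) (x y : genM e u) :
    ⟪compD e u x, y⟫_ℂ = ⟪x, compD e u y⟫_ℂ := by
  rw [← ContinuousLinearMap.adjoint_inner_right, (compD_isSelfAdjoint e u).adjoint_eq]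

theorem commute_compD_compH (e u : H →L[ℂ] H) : Commute (compD e u) (compH e u) :=
  commute_opSqrt ((Commute.refl _).mul_left ((Commute.one_left _).sub_left (Commute.refl _)))

namespace IsHermitianInvolution

variable {e u : H →L[ℂ] H} (hu : IsHermitianInvolution u)
include hu

theorem compD_mul_self (he : IsStarProjection e) :
    compD e u * compD e u = compH e u * (1 - compH e u) :=
  (opSqrt_spec _ (hu.compH_mul_nonneg he)).2

theorem coe_compD_compD (he : IsStarProjection e) (x : genM e u) :
    (compD e u (compD e u x) : H) = oddPart e u (oddPart e u x) := by
  rw [← hu.coe_compH_mul he, ← hu.compD_mul_self he]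
  rfl

theorem norm_compD (he : IsStarProjection e) (x : genM e u) :
    ‖compD e u x‖ = ‖oddPart e u x‖ := by
  rw [← sq_eq_sq₀ (norm_nonneg _) (norm_nonneg _)]
  have h : (⟪compD e u x, compD e u x⟫_ℂ) = ⟪oddPart e u x, oddPart e u x⟫_ℂ := by
    rw [inner_compD_left, Submodule.coe_inner, hu.coe_compD_compD he, hu.inner_oddPart_left he]
  rw [inner_self_eq_norm_sq_to_K, inner_self_eq_norm_sq_to_K] at h
  exact_mod_cast h

theorem eq_zero_of_compD_eq_zero (he : IsStarProjection e) {x : genM e u}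
    (hx : compD e u x = 0) : x = 0 := by
  have h1 := hu.norm_compD he x
  rw [hx, norm_zero, eq_comm, norm_eq_zero] at h1
  have h2 := ((hu.mem_genM he).1 x.2).2
  rw [Submodule.mem_orthogonal] at h2
  exact Subtype.ext (inner_self_eq_zero.1 (h2 x h1))

theorem denseRange_compD (he : IsStarProjection e) : DenseRange (compD e u) := by
  have h : (compD e u).rangeᗮ = ⊥ := by
    rw [ContinuousLinearMap.orthogonal_range, (compD_isSelfAdjoint e u).adjoint_eq]
    exact LinearMap.ker_eq_bot'.2 fun x hx => hu.eq_zero_of_compD_eq_zero he hx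
  exact Submodule.dense_iff_topologicalClosure_eq_top.2
    ((Submodule.topologicalClosure_eq_top_iff).2 h)

theorem eq_of_eq_on_range_compD (he : IsStarProjection e) {Y : Type*} [TopologicalSpace Y]
    [T2Space Y] {f g : genM e u → Y} (hf : Continuous f) (hg : Continuous g)
    (h : ∀ y, f (compD e u y) = g (compD e u y)) (x : genM e u) : f x = g x :=
  congr_fun (DenseRange.equalizer (hu.denseRange_compD he) hf hg (funext h)) x

/-- The isometric factor in the polar decomposition of the off-diagonal corner `oddPart e u`
restricted to `genM e u`, whose positive factor is `compD e u`. -/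
theorem exists_polar_isometry (he : IsStarProjection e) :
    ∃ V : genM e u →L[ℂ] H, (∀ x, V (compD e u x) = oddPart e u x) ∧ ∀ x, ‖V x‖ = ‖x‖ := by
  let f : genM e u →ₗ[ℂ] H := (oddPart e u : H →ₗ[ℂ] H) ∘ₗ (genM e u).subtype
  have hd : DenseRange (compD e u : genM e u →ₗ[ℂ] genM e u) := hu.denseRange_compD he
  have hV (x : genM e u) :
      f.extendOfNorm (compD e u : genM e u →ₗ[ℂ] genM e u) (compD e u x) = oddPart e u x :=
    LinearMap.extendOfNorm_eq hd ⟨1, fun y => by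
      simpa [f] using (hu.norm_compD he y).ge⟩ x
  exact ⟨_, hV, hu.eq_of_eq_on_range_compD he (ContinuousLinearMap.continuous _).norm
    continuous_norm fun y => by rw [hV, hu.norm_compD he]⟩

section Polar

variable {V : genM e u →L[ℂ] H} (he : IsStarProjection e)
  (hV : ∀ x, V (compD e u x) = oddPart e u x)
include he hV

theorem apply_polar (x : genM e u) : u (V x) = -V x := by
  refine hu.eq_of_eq_on_range_compD he (f := fun x => u (V x)) (g := fun x => -V x)
    (by fun_prop) (by fun_prop) (fun y => ?_) x
  rw [hV, hu.apply_oddPart, ((hu.mem_genM he).1 y.2).1]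

theorem oddPart_polar (x : genM e u) : oddPart e u (V x) = compD e u x := by
  refine hu.eq_of_eq_on_range_compD he (f := fun x => oddPart e u (V x))
    (g := fun x => (compD e u x : H)) (by fun_prop) (by fun_prop) (fun y => ?_) x
  rw [hV, hu.coe_compD_compD he]

theorem evenPart_polar (x : genM e u) : evenPart e u (V x) = V ((1 - compH e u) x) := by
  refine hu.eq_of_eq_on_range_compD he (f := fun x => evenPart e u (V x))
    (g := fun x => V ((1 - compH e u) x)) (by fun_prop) (by fun_prop) (fun y => ?_) x
  have hc : (1 - compH e u) (compD e u y) = compD e u ((1 - compH e u) y) :=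
    congr($(((Commute.one_left _).sub_left (commute_compD_compH e u).symm).eq) y)
  rw [hc, hV, hV, hu.evenPart_oddPart he, ← map_sub]
  simp [hu.coe_compH he]

theorem polar_mem_orthogonal_ker (x : genM e u) : V x ∈ (oddPart e u).kerᗮ := by
  refine (hu.denseRange_compD he).induction_on (p := fun x => V x ∈ (oddPart e u).kerᗮ) x
    ((Submodule.isClosed_orthogonal _).preimage V.continuous) fun y => ?_
  rw [hV]
  exact hu.oddPart_mem_orthogonal_ker he _

/-- `genM e u` and the range of `V` together exhaust the orthogonal complement of the kernel of
`oddPart e u`. -/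
theorem eq_zero_of_forall_inner_polar {w : H} (hwK : w ∈ (oddPart e u).kerᗮ)
    (hw1 : ∀ x : genM e u, ⟪w, x⟫_ℂ = 0) (hw2 : ∀ x, ⟪w, V x⟫_ℂ = 0) : w = 0 := by
  -- `w + u w` lies in `genM e u`, hence is orthogonal to `w` and therefore zero.
  have hpM : w + u w ∈ genM e u := by
    rw [hu.mem_genM he]
    exact ⟨by rw [map_add, hu.apply_apply, add_comm],
      add_mem hwK (hu.apply_mem_orthogonal_ker hwK)⟩
  have huw : u w = -w := by
    have h1 : ⟪w, w + u w⟫_ℂ = 0 := hw1 ⟨_, hpM⟩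
    have h2 : ⟪u w, w + u w⟫_ℂ = 0 := by
      rw [hu.inner_left, map_add, hu.apply_apply, add_comm]
      exact h1
    have h3 : ⟪w + u w, w + u w⟫_ℂ = 0 := by rw [inner_add_left, h1, h2, add_zero]
    exact eq_neg_of_add_eq_zero_right (inner_self_eq_zero.1 h3)
  -- Now `oddPart e u w` lies in `genM e u` and is orthogonal to itself.
  have hTM : oddPart e u w ∈ genM e u := by
    rw [hu.mem_genM he]
    exact ⟨by rw [hu.apply_oddPart, huw, map_neg, neg_neg], hu.oddPart_mem_orthogonal_ker he w⟩
  have hTw : oddPart e u w = 0 := by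
    have h1 := hw2 (compD e u ⟨_, hTM⟩)
    rw [hV, ← hu.inner_oddPart_left he] at h1
    exact inner_self_eq_zero.1 h1
  rw [Submodule.mem_orthogonal] at hwK
  exact inner_self_eq_zero.1 (hwK w hTw)

end Polar

end IsHermitianInvolution

/-- The isometry `(x, y) ↦ x + V y` on `K ⊕ K`, for a subspace `K` and an isometry `V` on `K` with
range orthogonal to `K`. -/
def prodIsometry (K : Submodule ℂ H) (V : K →L[ℂ] H) (hn : ∀ x, ‖V x‖ = ‖x‖)
    (ho : ∀ x y : K, ⟪(x : H), V y⟫_ℂ = 0) : WithLp 2 (K × K) →ₗᵢ[ℂ] H where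
  toLinearMap := (K.subtype.coprod (V : K →ₗ[ℂ] H)) ∘ₗ
    (WithLp.linearEquiv 2 ℂ (K × K)).toLinearMap
  norm_map' := by
    rintro ⟨x, y⟩
    change ‖(x : H) + V y‖ = _
    rw [← sq_eq_sq₀ (norm_nonneg _) (norm_nonneg _), WithLp.prod_norm_sq_eq_of_L2, sq,
      norm_add_sq_eq_norm_sq_add_norm_sq_of_inner_eq_zero _ _ (ho x y), hn, ← sq, ← sq]
    rfl

theorem prodIsometry_apply (K : Submodule ℂ H) (V : K →L[ℂ] H) (hn : ∀ x, ‖V x‖ = ‖x‖)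
    (ho : ∀ x y : K, ⟪(x : H), V y⟫_ℂ = 0) (x y : K) :
    prodIsometry K V hn ho (WithLp.toLp 2 (x, y)) = x + V y := rfl

namespace IsHermitianInvolution

variable {e u : H →L[ℂ] H} (hu : IsHermitianInvolution u)
include hu

theorem nonempty_halmosForm (he : IsStarProjection e) : Nonempty (HalmosForm e u) := by
  obtain ⟨V, hV, hVn⟩ := hu.exists_polar_isometry he
  have hM (x : genM e u) := (hu.mem_genM he).1 x.2
  have huV := hu.apply_polar he hV
  have ho (x y : genM e u) : ⟪(x : H), V y⟫_ℂ = 0 := hu.inner_eq_zero (hM x).1 (huV y)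
  refine ⟨⟨prodIsometry _ V hVn ho, ?_, fun x => ?_, ?_, ?_⟩⟩
  · rw [← hu.ker_oddPart he]
    set J := prodIsometry _ V hVn ho with hJ
    have hle : J.toLinearMap.range ≤ (oddPart e u).kerᗮ := by
      rintro _ ⟨⟨x, y⟩, rfl⟩
      exact add_mem (hM x).2 (hu.polar_mem_orthogonal_ker he hV y)
    have : CompleteSpace J.toLinearMap.range :=
      IsComplete.completeSpace_coe (s := (J.toLinearMap.range : Set H)) <| by
        rw [LinearMap.coe_range]
        exact J.isometry.isUniformInducing.isComplete_range
    refine le_antisymm hle fun z hz => ?_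
    have hwR := Submodule.sub_starProjection_mem_orthogonal (K := J.toLinearMap.range) z
    rw [Submodule.mem_orthogonal'] at hwR
    have hw : z - J.toLinearMap.range.starProjection z = 0 := by
      refine hu.eq_zero_of_forall_inner_polar he hV
        (sub_mem hz (hle (Submodule.starProjection_apply_mem _ _))) (fun x => ?_) fun y => ?_
      · exact hwR _ ⟨WithLp.toLp 2 (x, 0), by
          change J _ = _
          rw [hJ, prodIsometry_apply, map_zero, add_zero]⟩
      · exact hwR _ ⟨WithLp.toLp 2 (0, y), by
          change J _ = _
          rw [hJ, prodIsometry_apply, ZeroMemClass.coe_zero, zero_add]⟩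
    rw [sub_eq_zero.1 hw]
    exact Submodule.starProjection_apply_mem _ _
  · rw [prodIsometry_apply, map_zero, add_zero]
  · ext ⟨x, y⟩
    change u (x + V y) = (((1 : genM e u →L[ℂ] genM e u) x + (0 : genM e u →L[ℂ] genM e u) y
      : genM e u) : H) + V ((0 : genM e u →L[ℂ] genM e u) x + (-1 : genM e u →L[ℂ] genM e u) y)
    rw [map_add, (hM x).1, huV]
    simp
  · ext ⟨x, y⟩
    change e (x + V y) = ((compH e u x + compD e u y : genM e u) : H) +
      V (compD e u x + (1 - compH e u) y)
    have h1 (z : H) : e z = evenPart e u z + oddPart e u z := by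
      rw [← add_apply, evenPart_add_oddPart]
    rw [map_add, h1, h1 (V y), hu.oddPart_polar he hV, hu.evenPart_polar he hV, map_add V, hV,
      Submodule.coe_add, hu.coe_compH he]
    abel

end IsHermitianInvolution

/-! ### Block operators and the midpoint projection `q₀` -/

section Block

variable {K : Type v} [NormedAddCommGroup K] [InnerProductSpace ℂ K]

theorem blockOp_comp (A B C D A' B' C' D' : K →L[ℂ] K) :
    blockOp A B C D ∘L blockOp A' B' C' D' =
      blockOp (A * A' + B * C') (A * B' + B * D') (C * A' + D * C') (C * B' + D * D') := by
  ext ⟨x, y⟩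
  simp only [ContinuousLinearMap.comp_apply, blockOp_apply, add_apply, map_add]
  congr 2
  · change _ = A (A' x) + B (C' x) + (A (B' y) + B (D' y))
    abel
  · change _ = C (A' x) + D (C' x) + (C (B' y) + D (D' y))
    abel

theorem blockOp_sub (A B C D A' B' C' D' : K →L[ℂ] K) :
    blockOp A B C D - blockOp A' B' C' D' = blockOp (A - A') (B - B') (C - C') (D - D') := by
  ext ⟨x, y⟩
  simp only [sub_apply, blockOp_apply, ← WithLp.toLp_sub, Prod.mk_sub_mk]
  congr 2 <;> abel

theorem blockOp_add (A B C D A' B' C' D' : K →L[ℂ] K) :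
    blockOp A B C D + blockOp A' B' C' D' = blockOp (A + A') (B + B') (C + C') (D + D') := by
  ext ⟨x, y⟩
  simp only [add_apply, blockOp_apply, ← WithLp.toLp_add, Prod.mk_add_mk]
  congr 2 <;> abel

theorem smul_blockOp (c : ℂ) (A B C D : K →L[ℂ] K) :
    c • blockOp A B C D = blockOp (c • A) (c • B) (c • C) (c • D) := by
  ext ⟨x, y⟩
  simp only [smul_apply, blockOp_apply, ← WithLp.toLp_smul, Prod.smul_mk, smul_add]

theorem blockOp_zero : blockOp 0 0 0 0 = (0 : WithLp 2 (K × K) →L[ℂ] WithLp 2 (K × K)) := by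
  ext ⟨x, y⟩
  simp [blockOp_apply]

variable [CompleteSpace K]

theorem isSelfAdjoint_blockOp {A B D : K →L[ℂ] K} (hA : IsSelfAdjoint A) (hB : IsSelfAdjoint B)
    (hD : IsSelfAdjoint D) : IsSelfAdjoint (blockOp A B B D) := by
  rw [ContinuousLinearMap.isSelfAdjoint_iff_isSymmetric] at hA hB hD ⊢
  rintro ⟨x, y⟩ ⟨x', y'⟩
  have hA := hA x x'
  have hB1 := hB x y'
  have hB2 := hB y x'
  have hD := hD y y'
  simp only [ContinuousLinearMap.coe_coe] at hA hB1 hB2 hD ⊢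
  simp only [blockOp_apply, WithLp.prod_inner_apply, inner_add_left, inner_add_right, hA, hB1, hB2,
    hD]
  ring

theorem blockOp_diag_nonneg {D : K →L[ℂ] K} (hD : 0 ≤ D) : 0 ≤ blockOp D 0 0 D := by
  rw [ContinuousLinearMap.nonneg_iff_isPositive] at hD ⊢
  refine ContinuousLinearMap.isPositive_def'.2
    ⟨isSelfAdjoint_blockOp hD.isSelfAdjoint (.zero _) hD.isSelfAdjoint, ?_⟩
  rintro ⟨x, y⟩
  simpa [ContinuousLinearMap.reApplyInnerSelf_apply, blockOp_apply, WithLp.prod_inner_apply] using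
    add_nonneg (hD.re_inner_nonneg_left x) (hD.re_inner_nonneg_left y)

/-- The square root inherits a lower bound, as it is operator monotone. -/
theorem le_re_inner_opSqrt {A : K →L[ℂ] K} (hA : 0 ≤ A) {k : ℝ} (hk : 0 ≤ k)
    (h : ∀ x, k ^ 2 * ‖x‖ ^ 2 ≤ (⟪A x, x⟫_ℂ).re) (x : K) :
    k * ‖x‖ ^ 2 ≤ (⟪opSqrt A x, x⟫_ℂ).re := by
  lift k to NNReal using hk
  have hin (B : K →L[ℂ] K) (r : NNReal) (y : K) :
      (⟪(B - algebraMap NNReal (K →L[ℂ] K) r) y, y⟫_ℂ).re =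
        (⟪B y, y⟫_ℂ).re - r * ‖y‖ ^ 2 := by
    have h1 : algebraMap NNReal (K →L[ℂ] K) r y = ((r : ℝ) : ℂ) • y := by
      rw [Algebra.algebraMap_eq_smul_one]
      rfl
    rw [sub_apply, inner_sub_left, h1, inner_smul_left, inner_self_eq_norm_sq_to_K]
    simp [← Complex.ofReal_pow]
  have h1 : algebraMap NNReal (K →L[ℂ] K) (k ^ 2) ≤ A := by
    rw [ContinuousLinearMap.le_def, ContinuousLinearMap.isPositive_def']
    refine ⟨?_, fun y => ?_⟩
    · exact (IsSelfAdjoint.of_nonneg hA).sub (IsSelfAdjoint.of_nonneg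
        (algebraMap_nonneg _ zero_le))
    · have := h y
      rw [ContinuousLinearMap.reApplyInnerSelf_apply]
      change 0 ≤ (⟪_, y⟫_ℂ).re
      rw [hin]
      push_cast
      linarith
  have h2 := CFC.monotone_sqrt h1
  rw [CFC.sqrt_algebraMap, NNReal.sqrt_sq, ContinuousLinearMap.le_def,
    ContinuousLinearMap.isPositive_def'] at h2
  have h3 := h2.2 x
  rw [ContinuousLinearMap.reApplyInnerSelf_apply] at h3
  change 0 ≤ (⟪_, x⟫_ℂ).re at h3
  rw [hin] at h3
  change _ ≤ (⟪CFC.sqrt A x, x⟫_ℂ).re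
  linarith

end Block


theorem adjoint_comp_self_of_linearIsometry {E : Type*} [NormedAddCommGroup E]
    [InnerProductSpace ℂ E] [CompleteSpace E] (J : E →ₗᵢ[ℂ] H) :
    ContinuousLinearMap.adjoint J.toContinuousLinearMap ∘L J.toContinuousLinearMap = 1 :=
  (ContinuousLinearMap.norm_map_iff_adjoint_comp_self _).1 J.norm_map

namespace HalmosForm

variable {e u : H →L[ℂ] H} (F : HalmosForm e u)

/-- The operator on `H` that is `B` on the generic part `M ⊕ M` and zero on its complement. -/
def lift (B : WithLp 2 (genM e u × genM e u) →L[ℂ] WithLp 2 (genM e u × genM e u)) : H →L[ℂ] H :=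
  F.J.toContinuousLinearMap ∘L B ∘L ContinuousLinearMap.adjoint F.J.toContinuousLinearMap

variable (B C : WithLp 2 (genM e u × genM e u) →L[ℂ] WithLp 2 (genM e u × genM e u))

theorem adjoint_J_J (z : WithLp 2 (genM e u × genM e u)) :
    ContinuousLinearMap.adjoint F.J.toContinuousLinearMap (F.J z) = z :=
  congr($(adjoint_comp_self_of_linearIsometry F.J) z)

theorem lift_J (z : WithLp 2 (genM e u × genM e u)) : F.lift B (F.J z) = F.J (B z) :=
  congr(F.J (B $(F.adjoint_J_J z)))

theorem lift_mul : F.lift B * F.lift C = F.lift (B ∘L C) := by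
  ext x
  exact F.lift_J B _

theorem lift_sub : F.lift (B - C) = F.lift B - F.lift C := by
  ext x
  exact map_sub F.J _ _

theorem lift_add : F.lift (B + C) = F.lift B + F.lift C := by
  ext x
  exact map_add F.J _ _

theorem lift_smul (c : ℂ) : F.lift (c • B) = c • F.lift B := by
  ext x
  exact map_smul F.J _ _

theorem lift_zero : F.lift 0 = 0 := by
  ext x
  exact map_zero F.J

theorem isSelfAdjoint_lift {B : WithLp 2 (genM e u × genM e u) →L[ℂ] WithLp 2 (genM e u × genM e u)}
    (hB : IsSelfAdjoint B) : IsSelfAdjoint (F.lift B) :=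
  hB.conj_adjoint F.J.toContinuousLinearMap

theorem lift_nonneg {B : WithLp 2 (genM e u × genM e u) →L[ℂ] WithLp 2 (genM e u × genM e u)}
    (hB : 0 ≤ B) : 0 ≤ F.lift B := by
  rw [ContinuousLinearMap.nonneg_iff_isPositive] at hB ⊢
  exact hB.conj_adjoint F.J.toContinuousLinearMap

theorem norm_adjoint_J_le (x : H) :
    ‖ContinuousLinearMap.adjoint F.J.toContinuousLinearMap x‖ ≤ ‖x‖ := by
  refine (ContinuousLinearMap.le_opNorm _ _).trans (mul_le_of_le_one_left (norm_nonneg _) ?_)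
  rw [LinearIsometryEquiv.norm_map]
  exact F.J.norm_toContinuousLinearMap_le

theorem norm_lift_le : ‖F.lift B‖ ≤ ‖B‖ := by
  refine ContinuousLinearMap.opNorm_le_bound _ B.opNorm_nonneg fun x => ?_
  change ‖F.J (B _)‖ ≤ _
  rw [F.J.norm_map]
  exact (B.le_opNorm _).trans (by gcongr; exact F.norm_adjoint_J_le x)

theorem q0_eq : F.q0 = F.lift ((1 / 2 : ℂ) • blockOp 1 1 1 1) := rfl

theorem mul_lift : u * F.lift B = F.lift (blockOp 1 0 0 (-1) ∘L B) := by
  ext x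
  exact congr($F.u_form (B (ContinuousLinearMap.adjoint F.J.toContinuousLinearMap x)))

theorem lift_mul_right (hu : IsHermitianInvolution u) :
    F.lift B * u = F.lift (B ∘L blockOp 1 0 0 (-1)) := by
  have h : ContinuousLinearMap.adjoint F.J.toContinuousLinearMap ∘L u =
      blockOp 1 0 0 (-1) ∘L ContinuousLinearMap.adjoint F.J.toContinuousLinearMap := by
    have h1 := congr(ContinuousLinearMap.adjoint $F.u_form)
    rw [ContinuousLinearMap.adjoint_comp, ContinuousLinearMap.adjoint_comp,
      hu.isSelfAdjoint.adjoint_eq,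
      (isSelfAdjoint_blockOp (.one _) (.zero _) (IsSelfAdjoint.one _).neg).adjoint_eq] at h1
    exact h1
  ext x
  exact congr(F.J (B ($h x)))

theorem eq_lift (h0 : M00 e u = ⊥) (h1 : M11 e u = ⊥) :
    e = F.lift (blockOp (compH e u) (compD e u) (compD e u) (1 - compH e u)) := by
  ext x
  set y := ContinuousLinearMap.adjoint F.J.toContinuousLinearMap x
  have h2 : x - F.J y ∈ F.J.toLinearMap.rangeᗮ := by
    rw [Submodule.mem_orthogonal]
    rintro _ ⟨z, rfl⟩
    have h3 := (ContinuousLinearMap.adjoint_inner_right F.J.toContinuousLinearMap z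
      (x - F.J y)).symm
    refine h3.trans ?_
    rw [map_sub, F.adjoint_J_J, sub_self, inner_zero_right]
  have h3 : x - F.J y ∈ e.ker := by
    rw [F.range_J, h0, h1, bot_sup_eq, sup_bot_eq,
      Submodule.orthogonal_orthogonal_eq_closure] at h2
    exact Submodule.topologicalClosure_minimal _ (sup_le inf_le_left inf_le_left)
      e.isClosed_ker h2
  have h4 : e x = e (F.J y) := by
    have h5 : e (x - F.J y) = 0 := h3
    rwa [map_sub, sub_eq_zero] at h5
  rw [h4]
  exact congr($F.e_form y)

theorem oddPart_eq_lift (hu : IsHermitianInvolution u) (h0 : M00 e u = ⊥) (h1 : M11 e u = ⊥) :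
    oddPart e u = F.lift (blockOp 0 (compD e u) (compD e u) 0) := by
  have h := F.eq_lift h0 h1
  have h2 : oddPart e u = (1 / 2 : ℂ) •
      (F.lift (blockOp (compH e u) (compD e u) (compD e u) (1 - compH e u)) -
      u * F.lift (blockOp (compH e u) (compD e u) (compD e u) (1 - compH e u)) * u) := by
    rw [← h]
    rfl
  rw [h2, mul_lift, lift_mul_right F _ hu, ← lift_sub, ← lift_smul]
  congr 1
  rw [blockOp_comp, blockOp_comp, blockOp_sub, smul_blockOp]
  congr 1 <;> simp <;> module

theorem q0_mem_projQ (hu : IsHermitianInvolution u) : F.q0 ∈ projQ u := by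
  have hs : IsSelfAdjoint (blockOp 1 1 1 1 :
      WithLp 2 (genM e u × genM e u) →L[ℂ] WithLp 2 (genM e u × genM e u)) :=
    isSelfAdjoint_blockOp (.one _) (.one _) (.one _)
  refine ⟨⟨?_, F.isSelfAdjoint_lift (.smul (r := (1 / 2 : ℂ)) (by simp [IsSelfAdjoint]) hs)⟩, ?_⟩
  · rw [IsIdempotentElem, q0_eq, lift_mul, smul_blockOp, blockOp_comp]
    congr 2 <;> simp <;> module
  · rw [q0_eq, lift_mul_right F _ hu, lift_mul, smul_blockOp, blockOp_comp, blockOp_comp,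
      ← F.lift_zero, ← blockOp_zero]
    congr 2 <;> simp

/-- The flip `(x, y) ↦ (y, x)` of `M ⊕ M`, extended by zero, is the partial isometry in the polar
decomposition of the odd part of `e`, whose absolute value is `diag[√(H(I - H)), √(H(I - H))]`.
So everything that commutes with `e` and `u` commutes with it. -/
theorem commute_lift_swap (he : IsStarProjection e) (hu : IsHermitianInvolution u)
    (h0 : M00 e u = ⊥) (h1 : M11 e u = ⊥) {x : H →L[ℂ] H}
    (hxe : Commute x e) (hxu : Commute x u) :
    Commute x (F.lift (blockOp 0 1 1 0)) := by
  set S := F.lift (blockOp 0 1 1 0) with hS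
  set A := F.lift (blockOp (compD e u) 0 0 (compD e u)) with hA
  have hSs : IsSelfAdjoint S :=
    F.isSelfAdjoint_lift (isSelfAdjoint_blockOp (.zero _) (.one _) (.zero _))
  have hSSS : S * (S * S) = S := by
    simp only [hS, lift_mul, blockOp_comp]
    congr 2 <;> simp
  have hSA : S * A = oddPart e u := by
    rw [F.oddPart_eq_lift hu h0 h1, hS, hA, lift_mul, blockOp_comp]
    congr 2 <;> simp
  have hAA : A = opSqrt (oddPart e u * oddPart e u) := by
    refine (CFC.sqrt_unique ?_ (F.lift_nonneg (blockOp_diag_nonneg (compD_nonneg e u)))).symm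
    rw [F.oddPart_eq_lift hu h0 h1, lift_mul, lift_mul, blockOp_comp, blockOp_comp]
    congr 2 <;> simp
  have key {y : H →L[ℂ] H} (hye : Commute y e) (hyu : Commute y u) : y * S = S * y * (S * S) := by
    have hT : Commute y (oddPart e u) :=
      (hye.sub_right ((hyu.mul_right hye).mul_right hyu)).smul_right _
    have hcA : Commute A y := by
      rw [hAA]
      exact commute_opSqrt (hT.mul_right hT).symm
    have h2 : (y * S - S * y) * A = 0 := by
      rw [sub_mul, mul_assoc, mul_assoc S, ← hcA.eq, ← mul_assoc S, hSA, hT.eq, sub_self]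
    have hAJ (a b : genM e u) : A (F.J (WithLp.toLp 2 (a, b))) =
        F.J (WithLp.toLp 2 (compD e u a, compD e u b)) := by
      rw [hA, lift_J, blockOp_apply]
      simp
    -- `A` maps `M ⊕ M` onto a dense subspace, as `√(H(I - H))` has dense range.
    have h3 (a b : genM e u) : (y * S - S * y) (F.J (WithLp.toLp 2 (a, b))) = 0 := by
      have hfst (a : genM e u) : (y * S - S * y) (F.J (WithLp.toLp 2 (a, 0))) = 0 := by
        refine hu.eq_of_eq_on_range_compD he
          (f := fun a => (y * S - S * y) (F.J (WithLp.toLp 2 (a, 0)))) (g := fun _ => 0)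
          (by fun_prop) (by fun_prop) (fun c => ?_) a
        have h4 := hAJ c 0
        rw [map_zero] at h4
        rw [← h4]
        exact congr($h2 _)
      have hsnd (b : genM e u) : (y * S - S * y) (F.J (WithLp.toLp 2 (0, b))) = 0 := by
        refine hu.eq_of_eq_on_range_compD he
          (f := fun b => (y * S - S * y) (F.J (WithLp.toLp 2 (0, b)))) (g := fun _ => 0)
          (by fun_prop) (by fun_prop) (fun c => ?_) b
        have h4 := hAJ 0 c
        rw [map_zero] at h4
        rw [← h4]
        exact congr($h2 _)
      have h5 : WithLp.toLp 2 (a, b) = WithLp.toLp 2 (a, 0) + WithLp.toLp 2 (0, b) := by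
        rw [← WithLp.toLp_add]
        simp
      rw [h5, map_add, map_add, hfst, hsnd, add_zero]
    have h6 : (y * S - S * y) * S = 0 := by
      ext z
      exact h3 _ _
    have h7 : (y * S - S * y) * (S * S) = 0 := by rw [← mul_assoc, h6, zero_mul]
    rw [sub_mul, sub_eq_zero, mul_assoc y, hSSS] at h7
    exact h7
  have k1 := key hxe hxu
  -- The same identity for `x*`, after taking adjoints.
  have k2 : S * x = S * S * x * S := by
    have h8 := congr(star $(key (y := star x) ?_ ?_))
    · simpa [hSs.star_eq, mul_assoc] using h8
    · simpa [he.isSelfAdjoint.star_eq] using hxe.star_star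
    · simpa [hu.isSelfAdjoint.star_eq] using hxu.star_star
  calc x * S = S * x * (S * S) := k1
    _ = S * (x * S) * S := by simp only [mul_assoc]
    _ = S * (S * x * (S * S)) * S := by rw [← k1]
    _ = (S * S * x * S) * (S * S) := by simp only [mul_assoc]
    _ = S * S * x * (S * (S * S)) := by simp only [mul_assoc]
    _ = S * x := by rw [hSSS, ← k2]

theorem q0_mem_wStar (he : IsStarProjection e) (hu : IsHermitianInvolution u)
    (h0 : M00 e u = ⊥) (h1 : M11 e u = ⊥) : F.q0 ∈ (wStar {e, u} : Set (H →L[ℂ] H)) := by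
  rw [coe_wStar, Set.mem_centralizer_iff]
  intro x hx
  rw [Set.mem_centralizer_iff] at hx
  have hS := F.commute_lift_swap he hu h0 h1 (x := x) (hx e (by simp)).symm (hx u (by simp)).symm
  have hq : F.q0 = (1 / 2 : ℂ) • (F.lift (blockOp 0 1 1 0) * F.lift (blockOp 0 1 1 0) +
      F.lift (blockOp 0 1 1 0)) := by
    rw [q0_eq, lift_mul, ← lift_add, ← lift_smul, blockOp_comp, blockOp_add]
    congr 3 <;> simp
  rw [hq]
  exact (((hS.mul_right hS).add_right hS).smul_right _).eq

end HalmosForm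

/-! ### The distance -/

theorem inner_left_of_isSelfAdjoint {A : H →L[ℂ] H} (hA : IsSelfAdjoint A) (x y : H) :
    ⟪A x, y⟫_ℂ = ⟪x, A y⟫_ℂ :=
  ContinuousLinearMap.isSelfAdjoint_iff_isSymmetric.1 hA x y

theorem norm_sq_apply_of_isStarProjection {e : H →L[ℂ] H} (he : IsStarProjection e) (z : H) :
    ‖e z‖ ^ 2 = (⟪e z, z⟫_ℂ).re := by
  have h1 : ⟪e z, e z⟫_ℂ = ⟪e z, z⟫_ℂ := by
    rw [← inner_left_of_isSelfAdjoint he.isSelfAdjoint]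
    exact congr(⟪$(he.isIdempotentElem.eq) z, z⟫_ℂ)
  rw [← h1, ← RCLike.re_eq_complex_re, inner_self_eq_norm_sq]

theorem norm_sub_sq_of_isStarProjection {q : H →L[ℂ] H} (hq : IsStarProjection q) (z : H) :
    ‖z - q z‖ ^ 2 = ‖z‖ ^ 2 - ‖q z‖ ^ 2 := by
  have h := norm_sq_apply_of_isStarProjection hq z
  rw [norm_sub_rev, @norm_sub_sq ℂ, RCLike.re_eq_complex_re, ← h]
  ring

namespace IsHermitianInvolution

variable {e u : H →L[ℂ] H} (hu : IsHermitianInvolution u)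
include hu

theorem inner_compH_left (he : IsStarProjection e) (x y : genM e u) :
    ⟪compH e u x, y⟫_ℂ = ⟪x, compH e u y⟫_ℂ := by
  rw [Submodule.coe_inner, Submodule.coe_inner, hu.coe_compH he, hu.coe_compH he,
    hu.inner_evenPart_left he]

theorem isSelfAdjoint_compH (he : IsStarProjection e) : IsSelfAdjoint (compH e u) :=
  ContinuousLinearMap.isSelfAdjoint_iff_isSymmetric.2 (hu.inner_compH_left he)

theorem norm_add_sq_apply (x : H) : ‖x + u x‖ ^ 2 = 2 * ‖x‖ ^ 2 + 2 * (⟪u x, x⟫_ℂ).re := by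
  have h : ‖u x‖ ^ 2 = ‖x‖ ^ 2 := by
    rw [← inner_self_eq_norm_sq (𝕜 := ℂ), hu.inner_left, hu.apply_apply, inner_self_eq_norm_sq]
  rw [@norm_add_sq ℂ, h, RCLike.re_eq_complex_re, ← hu.inner_left]
  ring

theorem norm_sub_sq_apply (x : H) : ‖x - u x‖ ^ 2 = 2 * ‖x‖ ^ 2 - 2 * (⟪u x, x⟫_ℂ).re := by
  have h : ‖u x‖ ^ 2 = ‖x‖ ^ 2 := by
    rw [← inner_self_eq_norm_sq (𝕜 := ℂ), hu.inner_left, hu.apply_apply, inner_self_eq_norm_sq]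
  rw [@norm_sub_sq ℂ, h, RCLike.re_eq_complex_re, ← hu.inner_left]
  ring

/-- A vector in the range of some `q ∈ projQ u` has components of equal norm in the two eigenspaces
of `u`. So the component of `x` along the range of `q` is controlled by the arithmetic mean of the
norms of the components of `x` in the eigenspaces. -/
theorem norm_sq_apply_le_of_mem_projQ {q : H →L[ℂ] H} (hq : q ∈ projQ u) (x : H) :
    ‖q x‖ ^ 2 ≤ ‖x‖ ^ 2 / 2 + ‖x + u x‖ * ‖x - u x‖ / 4 := by
  obtain ⟨hq1, hq2⟩ := hq
  set y := q x with hy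
  have huy : (⟪u y, y⟫_ℂ).re = 0 := by
    have h1 : q (u y) = 0 := congr($hq2 x)
    have h2 : ⟪u y, y⟫_ℂ = ⟪q (u y), x⟫_ℂ :=
      (inner_left_of_isSelfAdjoint hq1.isSelfAdjoint _ _).symm
    rw [h2, h1, inner_zero_left, Complex.zero_re]
  have hp := hu.norm_add_sq_apply y
  have hm := hu.norm_sub_sq_apply y
  have hxp := hu.norm_add_sq_apply x
  have hxm := hu.norm_sub_sq_apply x
  rw [huy, mul_zero, add_zero] at hp
  rw [huy, mul_zero, sub_zero] at hm
  have hpm : ‖y - u y‖ = ‖y + u y‖ := by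
    rw [← sq_eq_sq₀ (norm_nonneg _) (norm_nonneg _), hp, hm]
  have h3 : 4 * ‖y‖ ^ 2 = (⟪y + u y, x + u x⟫_ℂ).re + (⟪y - u y, x - u x⟫_ℂ).re := by
    rw [hy, norm_sq_apply_of_isStarProjection hq1, ← hy]
    have h4 : ⟪u y, u x⟫_ℂ = ⟪y, x⟫_ℂ := by rw [hu.inner_left, hu.apply_apply]
    simp only [inner_add_left, inner_add_right, inner_sub_left, inner_sub_right, h4,
      Complex.add_re, Complex.sub_re]
    ring
  have h5 := re_inner_le_norm (𝕜 := ℂ) (y + u y) (x + u x)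
  have h6 := re_inner_le_norm (𝕜 := ℂ) (y - u y) (x - u x)
  rw [RCLike.re_eq_complex_re] at h5 h6
  rw [hpm] at h6
  set m := ‖y + u y‖
  have hm0 : 0 ≤ m := norm_nonneg _
  have h7 : 2 * m * m ≤ (‖x + u x‖ + ‖x - u x‖) * m := by nlinarith
  have h8 : (2 * m) ^ 2 ≤ (‖x + u x‖ + ‖x - u x‖) ^ 2 := by
    rcases hm0.eq_or_lt with h | h
    · rw [← h, mul_zero, zero_pow two_ne_zero]
      positivity
    · exact pow_le_pow_left₀ (by positivity) (le_of_mul_le_mul_right h7 h) 2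
  nlinarith

/-- The lower bound for the distance, valid without reference to the von Neumann algebra. -/
theorem sqrt_le_norm_sub (he : IsStarProjection e) {q : H →L[ℂ] H} (hq : q ∈ projQ u) :
    Real.sqrt (1 / 2 * (1 - Real.sqrt (1 - ‖e * u * e‖ ^ 2))) ≤ ‖e - q‖ := by
  refine Real.sqrt_le_iff.2 ⟨norm_nonneg _, ?_⟩
  set δ := ‖e - q‖
  suffices 1 - 2 * δ ^ 2 ≤ Real.sqrt (1 - ‖e * u * e‖ ^ 2) by linarith
  rcases le_total (1 - 2 * δ ^ 2) 0 with hs | hs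
  · exact hs.trans (Real.sqrt_nonneg _)
  set s := 1 - 2 * δ ^ 2 with hsdef
  have hs1 : 0 ≤ 1 - s ^ 2 := by nlinarith [sq_nonneg δ]
  refine Real.le_sqrt_of_sq_le ?_
  have hee (y : H) : e (e y) = e y := congr($he.isIdempotentElem.eq y)
  -- The numerical range of `u` on the range of `e` is bounded by `√(1 - s²)`.
  have key (x : H) (hx : e x = x) : |(⟪u x, x⟫_ℂ).re| ≤ Real.sqrt (1 - s ^ 2) * ‖x‖ ^ 2 := by
    have h1 : ‖x - q x‖ ≤ δ * ‖x‖ := by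
      have := (e - q).le_opNorm x
      rwa [sub_apply, hx] at this
    have h2 : ‖x - q x‖ ^ 2 ≤ δ ^ 2 * ‖x‖ ^ 2 := by
      rw [← mul_pow]
      exact pow_le_pow_left₀ (norm_nonneg _) h1 2
    rw [norm_sub_sq_of_isStarProjection hq.1] at h2
    have h3 := hu.norm_sq_apply_le_of_mem_projQ hq x
    have h4 : 2 * s * ‖x‖ ^ 2 ≤ ‖x + u x‖ * ‖x - u x‖ := by
      rw [hsdef]
      linarith
    have h5 : (2 * s * ‖x‖ ^ 2) ^ 2 ≤ ‖x + u x‖ ^ 2 * ‖x - u x‖ ^ 2 := by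
      rw [← mul_pow]
      exact pow_le_pow_left₀ (by positivity) h4 2
    rw [hu.norm_add_sq_apply, hu.norm_sub_sq_apply] at h5
    refine abs_le_of_sq_le_sq ?_ (by positivity)
    rw [mul_pow, Real.sq_sqrt hs1]
    linarith
  have hsymm : (e * u * e).IsSymmetric := by
    rw [← ContinuousLinearMap.isSelfAdjoint_iff_isSymmetric]
    simpa [he.isSelfAdjoint.star_eq] using hu.isSelfAdjoint.conjugate e
  have hnorm : ‖e * u * e‖ ≤ Real.sqrt (1 - s ^ 2) := by
    rw [ContinuousLinearMap.norm_eq_iSup_rayleighQuotient _ hsymm]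
    refine ciSup_le fun x => ?_
    have h1 : (e * u * e).reApplyInnerSelf x = (⟪u (e x), e x⟫_ℂ).re :=
      congr(Complex.re $(inner_left_of_isSelfAdjoint he.isSelfAdjoint (u (e x)) x))
    rw [ContinuousLinearMap.rayleighQuotient, h1, abs_div, abs_of_nonneg (sq_nonneg ‖x‖)]
    refine div_le_of_le_mul₀ (sq_nonneg _) (Real.sqrt_nonneg _) ((key _ (hee x)).trans ?_)
    gcongr
    exact (e.le_opNorm x).trans (mul_le_of_le_one_left (norm_nonneg _) he.norm_le)
  have h2 := pow_le_pow_left₀ (norm_nonneg _) hnorm 2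
  rw [Real.sq_sqrt hs1] at h2
  linarith

end IsHermitianInvolution

namespace HalmosForm

variable {e u : H →L[ℂ] H}

/-- On the generic part, `e u e` acts as `(2 H - 1) e`, where `2 H - 1` is repeated along the
diagonal. Adding the norms over the two columns of `e` eliminates `e`. -/
theorem norm_two_compH_sub_one_le (F : HalmosForm e u) (he : IsStarProjection e)
    (hu : IsHermitianInvolution u) (x : genM e u) : ‖((2 : ℂ) • compH e u - 1) x‖ ≤ ‖e * u * e‖ * ‖x‖ := by
  set h := compH e u
  set d := compD e u
  set X := (2 : ℂ) • h - 1 with hX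
  have hdd : d * d = h * (1 - h) := hu.compD_mul_self he
  have hdh : d * h = h * d := (commute_compD_compH e u).eq
  have heJ (z) : e (F.J z) = F.J (blockOp h d d (1 - h) z) := congr($F.e_form z)
  have huJ (z) : u (F.J z) = F.J (blockOp 1 0 0 (-1) z) := congr($F.u_form z)
  have hblock : blockOp h d d (1 - h) ∘L blockOp 1 0 0 (-1) ∘L blockOp h d d (1 - h) =
      blockOp h d d (1 - h) ∘L blockOp X 0 0 X := by
    simp only [blockOp_comp, mul_zero, zero_mul, add_zero, zero_add, sub_zero, one_mul, hX, mul_neg,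
      neg_mul, mul_sub, sub_mul, mul_one, hdd, mul_smul_comm, hdh]
    congr 1 <;> module
  have hcol (z) : ‖e (F.J (blockOp X 0 0 X z))‖ ^ 2 ≤ ‖e * u * e‖ ^ 2 * ‖e (F.J z)‖ ^ 2 := by
    have h1 : e (F.J (blockOp X 0 0 X z)) = (e * u * e) (e (F.J z)) := by
      have h2 : (e * u * e) (e (F.J z)) = e (u (e (F.J z))) :=
        congr(e (u ($he.isIdempotentElem.eq (F.J z))))
      rw [h2, heJ, heJ, huJ, heJ]
      exact congr(F.J ($hblock z)).symm
    rw [h1, ← mul_pow]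
    exact pow_le_pow_left₀ (norm_nonneg _) (ContinuousLinearMap.le_opNorm _ _) 2
  have hsum (y : genM e u) :
      ‖e (F.J (WithLp.toLp 2 (y, 0)))‖ ^ 2 + ‖e (F.J (WithLp.toLp 2 (0, y)))‖ ^ 2 = ‖y‖ ^ 2 := by
    rw [norm_sq_apply_of_isStarProjection he, norm_sq_apply_of_isStarProjection he, heJ, heJ,
      F.J.inner_map_map, F.J.inner_map_map, blockOp_apply, blockOp_apply,
      WithLp.prod_inner_apply, WithLp.prod_inner_apply, ← inner_self_eq_norm_sq (𝕜 := ℂ) y]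
    simp [inner_sub_left]
  have h1 := hcol (WithLp.toLp 2 (x, 0))
  have h2 := hcol (WithLp.toLp 2 (0, x))
  simp only [blockOp_apply, map_zero, zero_apply, add_zero, zero_add] at h1 h2
  refine abs_le_of_sq_le_sq' ?_ (by positivity) |>.2
  rw [mul_pow, ← hsum x, ← hsum (X x)]
  linarith

theorem le_re_inner_compD (F : HalmosForm e u) (he : IsStarProjection e)
    (hu : IsHermitianInvolution u) (x : genM e u) :
    1 / 2 * Real.sqrt (1 - ‖e * u * e‖ ^ 2) * ‖x‖ ^ 2 ≤ (⟪compD e u x, x⟫_ℂ).re := by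
  refine le_re_inner_opSqrt (hu.compH_mul_nonneg he) (by positivity) (fun y => ?_) x
  set c := ‖e * u * e‖
  -- `H (I - H) = (I - (2 H - I)²) / 4`
  have h1 : (⟪(compH e u * (1 - compH e u)) y, y⟫_ℂ).re =
      (‖y‖ ^ 2 - ‖((2 : ℂ) • compH e u - 1) y‖ ^ 2) / 4 := by
    have h2 : (compH e u * (1 - compH e u)) y = compH e u (y - compH e u y) := rfl
    have h3 : ((2 : ℂ) • compH e u - 1) y = (2 : ℂ) • compH e u y - y := rfl
    rw [h2, h3, @norm_sub_sq ℂ, norm_smul, map_sub, inner_sub_left, inner_smul_left,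
      hu.inner_compH_left he (compH e u y) y, mul_pow, ← inner_self_eq_norm_sq (𝕜 := ℂ)
      (compH e u y)]
    simp [map_ofNat]
    ring
  have h4 : ‖((2 : ℂ) • compH e u - 1) y‖ ^ 2 ≤ c ^ 2 * ‖y‖ ^ 2 := by
    rw [← mul_pow]
    exact pow_le_pow_left₀ (norm_nonneg _) (F.norm_two_compH_sub_one_le he hu y) 2
  have h5 : c ≤ 1 := by
    have hu1 : ‖u‖ ≤ 1 := by
      have h6 := CStarRing.norm_self_mul_star (x := u)
      rw [hu.isSelfAdjoint.star_eq, hu.mul_self] at h6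
      have h7 : ‖(1 : H →L[ℂ] H)‖ ≤ 1 := ContinuousLinearMap.norm_id_le
      nlinarith [norm_nonneg u]
    calc c ≤ ‖e‖ * ‖u‖ * ‖e‖ := (norm_mul_le _ _).trans (by gcongr; exact norm_mul_le _ _)
      _ ≤ 1 * 1 * 1 := by gcongr <;> exact he.norm_le
      _ = 1 := by norm_num
  have h6 : 0 ≤ 1 - c ^ 2 := by
    have := pow_le_one₀ (n := 2) (norm_nonneg (e * u * e)) h5
    linarith
  rw [h1, mul_pow, Real.sq_sqrt h6]
  linarith

/-- The square of `e - q₀` is `diag[½ - √(H(I - H)), ½ - √(H(I - H))]` on the generic part. -/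
theorem norm_sub_q0_le (F : HalmosForm e u) (he : IsStarProjection e)
    (hu : IsHermitianInvolution u) (h0 : M00 e u = ⊥) (h1 : M11 e u = ⊥) :
    ‖e - F.q0‖ ≤ Real.sqrt (1 / 2 * (1 - Real.sqrt (1 - ‖e * u * e‖ ^ 2))) := by
  set c := ‖e * u * e‖
  set h := compH e u
  set d := compD e u
  set a : genM e u →L[ℂ] genM e u := (1 / 2 : ℂ) • 1 with ha
  have hdd : d * d = h * (1 - h) := hu.compD_mul_self he
  have hdh : d * h = h * d := (commute_compD_compH e u).eq
  have hsub : e - F.q0 = F.lift (blockOp (h - a) (d - a) (d - a) (1 - h - a)) := by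
    have h2 : e - F.q0 = F.lift (blockOp h d d (1 - h)) - F.q0 := by rw [← F.eq_lift h0 h1]
    rw [h2, q0_eq, ← lift_sub, smul_blockOp, blockOp_sub]
  have has : IsSelfAdjoint a := .smul (r := (1 / 2 : ℂ)) (by simp [IsSelfAdjoint])
    (IsSelfAdjoint.one (genM e u →L[ℂ] genM e u))
  have hhs : IsSelfAdjoint h := hu.isSelfAdjoint_compH he
  have hBs : IsSelfAdjoint (blockOp (h - a) (d - a) (d - a) (1 - h - a)) :=
    isSelfAdjoint_blockOp (hhs.sub has) ((compD_isSelfAdjoint e u).sub has)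
      (((IsSelfAdjoint.one _).sub hhs).sub has)
  have hBB : blockOp (h - a) (d - a) (d - a) (1 - h - a) ∘L
      blockOp (h - a) (d - a) (d - a) (1 - h - a) = blockOp (a - d) 0 0 (a - d) := by
    simp only [blockOp_comp, ha, mul_sub, sub_mul, mul_one, one_mul, hdd, mul_smul_comm,
      smul_mul_assoc, hdh]
    congr 1 <;> module
  rw [hsub]
  refine (F.norm_lift_le _).trans (ContinuousLinearMap.opNorm_le_bound _ (Real.sqrt_nonneg _) ?_)
  rintro ⟨x, y⟩
  set z : WithLp 2 (genM e u × genM e u) := WithLp.toLp 2 (x, y) with hz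
  set B := blockOp (h - a) (d - a) (d - a) (1 - h - a)
  have hin (w : genM e u) : (⟪(a - d) w, w⟫_ℂ).re ≤
      1 / 2 * (1 - Real.sqrt (1 - c ^ 2)) * ‖w‖ ^ 2 := by
    have h2 := F.le_re_inner_compD he hu w
    have h3 : (⟪(a - d) w, w⟫_ℂ).re = 1 / 2 * ‖w‖ ^ 2 - (⟪d w, w⟫_ℂ).re := by
      have h4 : (a - d) w = (1 / 2 : ℂ) • w - d w := rfl
      rw [h4, inner_sub_left, inner_smul_left, inner_self_eq_norm_sq_to_K]
      simp [← Complex.ofReal_pow, map_ofNat]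
    rw [h3]
    linarith
  have hsq : ‖B z‖ ^ 2 ≤ 1 / 2 * (1 - Real.sqrt (1 - c ^ 2)) * ‖z‖ ^ 2 := by
    have h2 : ‖B z‖ ^ 2 = (⟪(B ∘L B) z, z⟫_ℂ).re := by
      rw [← inner_self_eq_norm_sq (𝕜 := ℂ), ← ContinuousLinearMap.adjoint_inner_left,
        hBs.adjoint_eq]
      rfl
    rw [h2, hBB, hz, blockOp_apply, WithLp.prod_inner_apply, WithLp.prod_norm_sq_eq_of_L2]
    simp only [zero_apply, add_zero, zero_add, Complex.add_re]
    rw [mul_add]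
    exact add_le_add (hin x) (hin y)
  rw [← Real.sqrt_sq (norm_nonneg (B z)), ← Real.sqrt_sq (norm_nonneg z),
    ← Real.sqrt_mul' _ (sq_nonneg _)]
  exact Real.sqrt_le_sqrt hsq

end HalmosForm

/-- A common eigenvector `x` of `e` and `u` with `e x = x` is killed by every
`q ∈ projQ u ∩ wStar {e, u}`: the projection onto the line of `x` commutes with `e` and `u`, so `x`
is an eigenvector of `q`, and `q u q = 0` forces the eigenvalue to vanish. -/
theorem apply_eq_zero_of_mem_projQ {e u q : H →L[ℂ] H} (he : IsStarProjection e)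
    (hu : IsHermitianInvolution u) (hq : q ∈ projQ u ∩ (wStar {e, u} : Set (H →L[ℂ] H)))
    {x : H} (hex : e x = x) {ε : ℂ} (hε : ε * ε = 1) (hεr : star ε = ε) (hux : u x = ε • x) :
    q x = 0 := by
  rcases eq_or_ne x 0 with rfl | hx0
  · exact map_zero q
  obtain ⟨⟨hq1, hq2⟩, hq3⟩ := hq
  rw [coe_wStar, Set.mem_centralizer_iff] at hq3
  have hx : InnerProductSpace.rankOne ℂ x x ∈ Set.centralizer ({e, u} ∪ star {e, u}) := by
    have hcomm {m : H →L[ℂ] H} (hm : IsSelfAdjoint m) {t : ℂ} (ht : star t = t)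
        (hmx : m x = t • x) :
        m * InnerProductSpace.rankOne ℂ x x = InnerProductSpace.rankOne ℂ x x * m := by
      ext z
      change m (⟪x, z⟫_ℂ • x) = ⟪x, m z⟫_ℂ • x
      rw [← ContinuousLinearMap.adjoint_inner_left, hm.adjoint_eq, hmx, map_smul, hmx,
        inner_smul_left, starRingEnd_apply, ht, smul_smul, mul_comm]
    have hce := hcomm he.isSelfAdjoint (t := 1) (star_one _) (by rw [hex, one_smul])
    have hcu := hcomm hu.isSelfAdjoint hεr hux
    rw [Set.mem_centralizer_iff]
    rintro m ((rfl | rfl) | hm)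
    · exact hce
    · exact hcu
    · rcases Set.mem_star.1 hm with hm | hm
      · rwa [← star_star m, hm, he.isSelfAdjoint.star_eq]
      · rw [Set.mem_singleton_iff] at hm
        rwa [← star_star m, hm, hu.isSelfAdjoint.star_eq]
  -- `q x = t x` for `t = ⟪x, q x⟫ / ⟪x, x⟫`
  have hxx : ⟪x, x⟫_ℂ ≠ 0 := inner_self_ne_zero.2 hx0
  have h1 : ⟪x, q x⟫_ℂ • x = ⟪x, x⟫_ℂ • q x := by
    have h2 : ⟪x, q x⟫_ℂ • x = q (⟪x, x⟫_ℂ • x) := congr($(hq3 _ hx) x)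
    rw [h2, map_smul]
  obtain ⟨t, ht⟩ : ∃ t : ℂ, q x = t • x := by
    refine ⟨(⟪x, x⟫_ℂ)⁻¹ * ⟪x, q x⟫_ℂ, ?_⟩
    rw [mul_smul, h1, inv_smul_smul₀ hxx]
  have h3 : q (u (q x)) = 0 := congr($hq2 x)
  rw [ht, map_smul, hux, map_smul, map_smul, ht, smul_smul, smul_smul, smul_eq_zero] at h3
  have hε0 : ε ≠ 0 := by
    rintro rfl
    simp at hε
  have ht0 : t = 0 := by simpa [hε0, hx0] using h3
  rw [ht, ht0, zero_smul]

/-- The distance is at most one because the zero projection competes. -/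
theorem infDist_eq_one {e u : H →L[ℂ] H} (he : IsStarProjection e)
    (hu : IsHermitianInvolution u)
    (h : e.range ⊓ eigPlus u ≠ ⊥ ∨ e.range ⊓ eigMinus u ≠ ⊥) :
    Metric.infDist e (projQ u ∩ (wStar {e, u} : Set (H →L[ℂ] H))) = 1 := by
  have hee (y : H) : e (e y) = e y := congr($he.isIdempotentElem.eq y)
  obtain ⟨x, ε, hx0, hex, hε, hεr, hux⟩ : ∃ (x : H) (ε : ℂ), x ≠ 0 ∧ e x = x ∧ ε * ε = 1 ∧
      star ε = ε ∧ u x = ε • x := by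
    rcases h with h | h <;> obtain ⟨_, ⟨⟨y, rfl⟩, hx⟩, hx0⟩ := Submodule.exists_mem_ne_zero_of_ne_bot h
    · exact ⟨e y, 1, hx0, hee y, one_mul _, star_one _, by rw [one_smul]; exact mem_eigPlus.1 hx⟩
    · exact ⟨e y, -1, hx0, hee y, by norm_num, by simp, by
        rw [neg_one_smul]; exact mem_eigMinus.1 hx⟩
  refine le_antisymm ?_ ((Metric.le_infDist ⟨0, zero_mem u _⟩).2 fun q hq => ?_)
  · refine (Metric.infDist_le_dist_of_mem (zero_mem u _)).trans ?_
    rw [dist_zero_right]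
    exact he.norm_le
  · have h1 := (e - q).le_opNorm x
    rw [sub_apply, hex, apply_eq_zero_of_mem_projQ he hu hq hex hε hεr hux, sub_zero] at h1
    rw [dist_eq_norm]
    exact le_of_mul_le_mul_right (by rwa [one_mul]) (norm_pos_iff.2 hx0)

end ProjDist
end

theorem theorem1p2 {H : Type*} [NormedAddCommGroup H] [InnerProductSpace ℂ H] [CompleteSpace H]
    (e u : H →L[ℂ] H) (he : IsStarProjection e) (hu : ProjDist.IsHermitianInvolution u) :
    ((e.range ⊓ ProjDist.eigPlus u ≠ ⊥ ∨ e.range ⊓ ProjDist.eigMinus u ≠ ⊥) →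
      Metric.infDist e (ProjDist.projQ u ∩ (ProjDist.wStar {e, u} : Set (H →L[ℂ] H))) = 1) ∧
    (¬ (e.range ⊓ ProjDist.eigPlus u ≠ ⊥ ∨ e.range ⊓ ProjDist.eigMinus u ≠ ⊥) →
      Metric.infDist e (ProjDist.projQ u ∩ (ProjDist.wStar {e, u} : Set (H →L[ℂ] H))) =
          Real.sqrt (1 / 2 * (1 - Real.sqrt (1 - ‖e * u * e‖ ^ 2))) ∧
      Nonempty (ProjDist.HalmosForm e u) ∧
      ∀ F : ProjDist.HalmosForm e u,
        F.q0 ∈ ProjDist.projQ u ∩ (ProjDist.wStar {e, u} : Set (H →L[ℂ] H)) ∧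
        ‖e - F.q0‖ = Real.sqrt (1 / 2 * (1 - Real.sqrt (1 - ‖e * u * e‖ ^ 2)))) := by
  refine ⟨ProjDist.infDist_eq_one he hu, fun h => ?_⟩
  obtain ⟨h0, h1⟩ : ProjDist.M00 e u = ⊥ ∧ ProjDist.M11 e u = ⊥ := by
    rwa [not_or, not_not, not_not] at h
  have hmem (F : ProjDist.HalmosForm e u) :
      F.q0 ∈ ProjDist.projQ u ∩ (ProjDist.wStar {e, u} : Set (H →L[ℂ] H)) :=
    ⟨F.q0_mem_projQ hu, F.q0_mem_wStar he hu h0 h1⟩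
  obtain ⟨F₀⟩ := hu.nonempty_halmosForm he
  refine ⟨le_antisymm ?_ ?_, ⟨F₀⟩, fun F => ⟨hmem F, le_antisymm (F.norm_sub_q0_le he hu h0 h1)
    (hu.sqrt_le_norm_sub he (hmem F).1)⟩⟩
  · refine (Metric.infDist_le_dist_of_mem (hmem F₀)).trans ?_
    rw [dist_eq_norm]
    exact F₀.norm_sub_q0_le he hu h0 h1
  · refine (Metric.le_infDist ⟨0, ProjDist.zero_mem u _⟩).2 fun q hq => ?_
    rw [dist_eq_norm]
    exact hu.sqrt_le_norm_sub he hq.1
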